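/- **Lemma 6.3 (Rademacher complexity of the Picard class on the torus).** There is a universal constant $C>0$ such that the following holds. Let $d\ge 1$ be an integer, let $\mathbb T^d=\mathbb R^d/(2\pi\mathbb Z)^d$, and let $R,M,L,T>0$ and $\delta<1$ satisfy $$R+TLM\le M,\qquad TL\le\delta<1 .$$ Put $Q_T=\mathbb T^d\times(0,T)$ and $U_{0,R}=\{u_0\in C(\mathbb T^d;\mathbb R):\|u_0\|_{L^\infty}\le R\}$, and let $\mathcal F_{M,L}$ be the set of functions $F:[-M,M]\to\mathbb R$ with $F(0)=0$ that are Lipschitz with constant at most $L$. Let $e^{t\Delta}f=\sum_{\xi\in\mathbb Z^d}e^{-t|\xi|^2}\widehat f(\xi)\,e_\xi$ for $t>0$, where $e_\xi(x)=(2\pi)^{-d/2}e^{i\xi\cdot x}$ and $\widehat f(\xi)=\int_{\mathbb T^d}f\,\overline{e_\xi}\,dx$, and let $e^{0\Delta}f=f$, be the heat semigroup. For $F\in\mathcal F_{M,L}$ and $u_0\in U_{0,R}$ let $$\mathcal T_{F,u_0}[v](t)=e^{t\Delta}u_0+\int_0^t e^{(t-\tau)\Delta}F(v(\tau))\,d\tau$$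 be the Picard map on $\{v\in C([0,T];C(\mathbb T^d)):\|v\|_{L^\infty(Q_T)}\le M\}$. For $\ell\in\{0,1,2,\dots\}$ let $$\mathcal B_\ell=\{b_{F,\ell}:F\in\mathcal F_{M,L}\},\qquad b_{F,\ell}(u_0,z)=\bigl(\mathcal T_{F,u_0}^{[\ell]}[0]\bigr)(z)\quad(u_0\in U_{0,R},\ z\in Q_T),$$ where $\mathcal T^{[\ell]}$ denotes the $\ell$-fold composition. Let $n,q\ge1$, let $\mathcal S=\{(u_{0,i},\{z_{i,j}\}_{j=1}^q)\}_{i=1}^n$ be any sample with $u_{0,i}\in U_{0,R}$ and $z_{i,j}\in Q_T$, and let $$\widehat{\mathfrak R}_{\mathcal S}(\mathcal B_\ell)=\mathbb E_\sigma\Bigl[\sup_{b\in\mathcal B_\ell}\frac1{n\sqrt q}\sum_{i=1}^n\sum_{j=1}^q\sigma_{i,j}\,b(u_{0,i},z_{i,j})\Bigr]$$ be its trajectory-normalized empirical Rademacher complexity, where the $\sigma_{i,j}$ are independent and uniform on $\{-1,1\}$. Then, for every $\ell\in\{0,1,2,\dots\}$, the suprema in this definition are finite and $$\widehat{\mathfrak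 R}_{\mathcal S}(\mathcal B_\ell)\le CM\sqrt{\frac{LT(1-\delta^\ell)}{(1-\delta)n}} .$$ In particular, $\widehat{\mathfrak R}_{\mathcal S}(\mathcal B_\ell)\le CM\sqrt{\dfrac{LT}{(1-\delta)n}}$, a bound that is uniform in $\ell$. -/

import Mathlib

open scoped BigOperators ComplexConjugate

noncomputable section

instance factTwoPiPos : Fact (0 < 2 * Real.pi) := ⟨Real.two_pi_pos⟩

/-- The torus `𝕋^d = ℝ^d / (2πℤ)^d`. Its `volume` is Lebesgue measure, of total mass `(2π)^d`. -/
abbrev Torus (d : ℕ) : Type := Fin d → AddCircle (2 * Real.pi)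

/-- The Fourier basis function `e_ξ(x) = (2π)^{-d/2} exp(i ξ·x)`, for `ξ ∈ ℤ^d`. Mathlib's
`fourier k` on the circle `ℝ / 2πℤ` is `x ↦ exp(i k x)`. -/
def fourierMode {d : ℕ} (ξ : Fin d → ℤ) (x : Torus d) : ℂ :=
  (((2 * Real.pi) ^ (-(d : ℝ) / 2) : ℝ) : ℂ) * ∏ i, fourier (ξ i) (x i)

/-- The Fourier coefficient `f^(ξ) = ∫ f(x) conj(e_ξ(x)) dx`. -/
def torusFourierCoeff {d : ℕ} (f : Torus d → ℝ) (ξ : Fin d → ℤ) : ℂ :=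
  ∫ x : Torus d, (f x : ℂ) * conj (fourierMode ξ x)

/-- The heat semigroup `e^{tΔ} f = ∑_ξ e^{-t|ξ|²} f^(ξ) e_ξ` on the torus. For `t > 0` and bounded
measurable `f` the series converges absolutely, and its value is real because `f` is; at `t = 0`,
where the series of a continuous function need not converge pointwise, `e^{0Δ}` is the identity.
Negative times are never used. -/
def heatSemigroup {d : ℕ} (t : ℝ) (f : Torus d → ℝ) (x : Torus d) : ℝ :=
  if 0 < t then
    (∑' ξ : Fin d → ℤ,
      (Real.exp (-t * ∑ i, (ξ i : ℝ) ^ 2) : ℂ) * torusFourierCoeff f ξ * fourierMode ξ x).re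
  else f x

/-- The class `𝓕_{M,L}`: nonlinearities with `F(0) = 0` that are `L`-Lipschitz on `[-M,M]`.
Nothing is required off `[-M,M]`; the Picard iterates take their values in `[-M,M]`, so they only
depend on the restriction of `F` to this interval. -/
def nonlinearityClass (M L : ℝ) : Set (ℝ → ℝ) :=
  {F | F 0 = 0 ∧ ∀ s ∈ Set.Icc (-M) M, ∀ r ∈ Set.Icc (-M) M, |F s - F r| ≤ L * |s - r|}

/-- The initial data `U_{0,R}`: continuous functions on the torus with sup norm at most `R`. -/
def initialBall (d : ℕ) (R : ℝ) : Set C(Torus d, ℝ) := {v | ‖v‖ ≤ R}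

/-- The space-time domain `Q_T = 𝕋^d × (0,T)`. -/
def spaceTime (d : ℕ) (T : ℝ) : Set (Torus d × ℝ) := {z | z.2 ∈ Set.Ioo 0 T}

/-- The Picard map
`𝓣_{F,u₀}[v](t) = e^{tΔ} u₀ + ∫_0^t e^{(t-τ)Δ} F(v(τ)) dτ`, evaluated at `x`. -/
def picardMap {d : ℕ} (F : ℝ → ℝ) (u₀ : C(Torus d, ℝ)) (v : ℝ → Torus d → ℝ) :
    ℝ → Torus d → ℝ :=
  fun t x => heatSemigroup t u₀ x + ∫ τ in (0 : ℝ)..t, heatSemigroup (t - τ) (fun y => F (v τ y)) x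

/-- The `ℓ`-step Picard predictor `b_{F,ℓ}(u₀, z) = (𝓣_{F,u₀}^{[ℓ]}[0])(z)`, `z = (x,t) ∈ Q_T`. -/
def picardPredictor (d : ℕ) (R T : ℝ) (ℓ : ℕ) (F : ℝ → ℝ) (u₀ : initialBall d R)
    (z : spaceTime d T) : ℝ :=
  (picardMap F u₀.1)^[ℓ] (fun _ _ => 0) z.1.2 z.1.1

/-- The abstract `ℓ`-step Picard class `𝓑_ℓ = {b_{F,ℓ} : F ∈ 𝓕_{M,L}}`. -/
def picardClass (d : ℕ) (R M L T : ℝ) (ℓ : ℕ) : Set (initialBall d R → spaceTime d T → ℝ) :=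
  picardPredictor d R T ℓ '' nonlinearityClass M L

/-- The normalized Rademacher sum `(1 / (n √q)) ∑_i ∑_j σ_{ij} b(a_i, z_{ij})`. -/
def rademacherSum {X Z : Type*} {n q : ℕ} (a : Fin n → X) (z : Fin n → Fin q → Z)
    (σ : Fin n → Fin q → ℤˣ) (b : X → Z → ℝ) : ℝ :=
  1 / (n * Real.sqrt q) * ∑ i, ∑ j, ((σ i j : ℤ) : ℝ) * b (a i) (z i j)

/-- The trajectory-normalized empirical Rademacher complexity
`E_σ [ sup_{b ∈ 𝓑} (1 / (n √q)) ∑_i ∑_j σ_{ij} b(a_i, z_{ij}) ]` of the class `𝓑` on the sample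
`{(a_i, {z_{ij}}_j)}_i`. The `σ_{ij}` are independent uniform signs, so `E_σ` is the average over all
`2^{nq}` sign patterns (`ℤˣ = {1, -1}`). -/
def rademacherComplexity {X Z : Type*} {n q : ℕ} (B : Set (X → Z → ℝ)) (a : Fin n → X)
    (z : Fin n → Fin q → Z) : ℝ :=
  (∑ σ : Fin n → Fin q → ℤˣ, sSup (rademacherSum a z σ '' B)) / 2 ^ (n * q)

end

/-! The Picard class inherits the metric entropy of Lipschitz functions on an interval. The heat
kernel is nonnegative with integral one, so the semigroup contracts the sup norm. By Duhamel's
formula, a bound `D` on the distance between two iterates driven by `F` and `G` becomes `T * (η + L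
* D)` after one more step, where `η` bounds `|F - G|` on `[-M, M]`. Hence `F ↦ b_{F,ℓ}` is Lipschitz
in sup norm with constant `T * s`, `s = ∑_{k<ℓ} δ^k` (`abs_picard_iterate_sub_le`). Rounding on a
grid covers the nonlinearities at scale `3η` by `9 ^ ⌊ML/η⌋` of them
(`exists_net_nonlinearityClass`), so the log covering number of the sampled class at scale `ε` is of
order `LTsM/ε` (`exists_net_sampleValues`).

The square root of this entropy is integrable at `ε = 0`, so Dudley chaining built on Massart's
lemma (`sum_signs_sSup_le_of_entropy`) bounds the mean supremum over `N = nq` signs by `60 M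
√(N·LTs)`. Dividing by `n√q` cancels `q` and leaves `60 M √(LTs/n)`. All distances are sup norms, so
neither the dimension nor the location of the sample points enters. -/

/-! ### Rademacher sums: Massart's lemma and chaining. -/

theorem sum_signs_exp_eq_prod_cosh {ι : Type*} [Fintype ι] [DecidableEq ι] (v : ι → ℝ) :
    ∑ σ : ι → ℤˣ, Real.exp (∑ i, ((σ i : ℤ) : ℝ) * v i) = ∏ i, (2 * Real.cosh (v i)) := by
  have h : ∀ i, 2 * Real.cosh (v i) = ∑ s : ℤˣ, Real.exp (((s : ℤ) : ℝ) * v i) := by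
    intro i
    rw [UnitsInt.univ, Finset.sum_pair (by decide), Real.cosh_eq]
    simp; ring
  simp_rw [h]
  rw [Finset.prod_univ_sum, Fintype.piFinset_univ]
  simp_rw [Real.exp_sum]

theorem sum_signs_exp_le {ι : Type*} [Fintype ι] [DecidableEq ι] (v : ι → ℝ) :
    ∑ σ : ι → ℤˣ, Real.exp (∑ i, ((σ i : ℤ) : ℝ) * v i)
      ≤ 2 ^ Fintype.card ι * Real.exp ((∑ i, v i ^ 2) / 2) := by
  rw [sum_signs_exp_eq_prod_cosh, Finset.prod_mul_distrib, Finset.prod_const, Finset.card_univ,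
    Finset.sum_div, Real.exp_sum]
  gcongr with i
  exact Real.cosh_le_exp_half_sq _

theorem sum_signs_eq_zero {ι : Type*} [Fintype ι] [DecidableEq ι] (v : ι → ℝ) :
    ∑ σ : ι → ℤˣ, ∑ i, ((σ i : ℤ) : ℝ) * v i = 0 := by
  have h : ∑ σ : ι → ℤˣ, ∑ i, ((σ i : ℤ) : ℝ) * v i
      = ∑ σ : ι → ℤˣ, -∑ i, ((σ i : ℤ) : ℝ) * v i := by
    refine Fintype.sum_equiv (Equiv.neg (ι → ℤˣ)) _ _ fun σ => ?_
    simp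
  rw [Finset.sum_neg_distrib] at h
  linarith

/-- Massart's finite class lemma. -/
theorem sum_signs_le_of_finite {ι : Type*} [Fintype ι] [DecidableEq ι] (V : Finset (ι → ℝ))
    {r H : ℝ} (hr : 0 < r) (hH : 0 < H) (hcard : (V.card : ℝ) ≤ Real.exp H)
    (hV : ∀ v ∈ V, ∑ i, v i ^ 2 ≤ r ^ 2) (m : (ι → ℤˣ) → ℝ)
    (hm : ∀ σ, ∃ v ∈ V, m σ ≤ ∑ i, ((σ i : ℤ) : ℝ) * v i) :
    ∑ σ, m σ ≤ 2 ^ Fintype.card ι * (r * Real.sqrt (2 * H)) := by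
  set s := Real.sqrt (2 * H) with hs
  have hs0 : 0 < s := Real.sqrt_pos.2 (by linarith)
  have hs2 : s ^ 2 = 2 * H := Real.sq_sqrt (by linarith)
  set lam := s / r with hlam
  have hlam0 : 0 < lam := div_pos hs0 hr
  have hlr : lam * r = s := div_mul_cancel₀ _ hr.ne'
  -- The tangent bound `x ≤ exp (x - 2H) + 2H - 1` takes the place of Jensen's inequality. With `lam
  -- = √(2H)/r` the summed exponentials average to at most `exp H * exp H`, so the exponential term
  -- contributes at most `1` and cancels the `-1`.
  have hpt : ∀ σ, lam * m σ ≤ 2 * H - 1 +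
      Real.exp (-(2 * H)) * ∑ v ∈ V, Real.exp (∑ i, ((σ i : ℤ) : ℝ) * (lam * v i)) := by
    intro σ
    obtain ⟨v, hvV, hv⟩ := hm σ
    have h1 : lam * m σ ≤ ∑ i, ((σ i : ℤ) : ℝ) * (lam * v i) := by
      calc lam * m σ ≤ lam * ∑ i, ((σ i : ℤ) : ℝ) * v i := by gcongr
        _ = _ := by rw [Finset.mul_sum]; exact Finset.sum_congr rfl fun i _ => by ring
    have h2 := Real.add_one_le_exp ((∑ i, ((σ i : ℤ) : ℝ) * (lam * v i)) - 2 * H)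
    have h3 : Real.exp (∑ i, ((σ i : ℤ) : ℝ) * (lam * v i))
        ≤ ∑ v ∈ V, Real.exp (∑ i, ((σ i : ℤ) : ℝ) * (lam * v i)) :=
      Finset.single_le_sum (f := fun v : ι → ℝ => Real.exp (∑ i, ((σ i : ℤ) : ℝ) * (lam * v i)))
        (fun v _ => (Real.exp_pos _).le) hvV
    rw [sub_eq_add_neg, Real.exp_add, mul_comm (Real.exp _)] at h2
    have h4 := mul_le_mul_of_nonneg_left h3 (Real.exp_pos (-(2 * H))).le
    linarith
  have hcardσ : (Fintype.card (ι → ℤˣ) : ℝ) = 2 ^ Fintype.card ι := by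
    simp [Fintype.card_pi]
  have hsum : lam * ∑ σ, m σ ≤ 2 ^ Fintype.card ι * (2 * H) := by
    calc lam * ∑ σ, m σ = ∑ σ, lam * m σ := Finset.mul_sum _ _ _
      _ ≤ ∑ σ : ι → ℤˣ, (2 * H - 1 +
      Real.exp (-(2 * H)) * ∑ v ∈ V, Real.exp (∑ i, ((σ i : ℤ) : ℝ) * (lam * v i))) :=
          Finset.sum_le_sum fun σ _ => hpt σ
      _ = 2 ^ Fintype.card ι * (2 * H - 1) + Real.exp (-(2 * H)) *
          ∑ v ∈ V, ∑ σ : ι → ℤˣ, Real.exp (∑ i, ((σ i : ℤ) : ℝ) * (lam * v i)) := by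
          rw [Finset.sum_add_distrib, ← Finset.mul_sum, Finset.sum_comm, Finset.sum_const,
            Finset.card_univ, nsmul_eq_mul, hcardσ]
      _ ≤ 2 ^ Fintype.card ι * (2 * H - 1) + Real.exp (-(2 * H)) *
          ∑ v ∈ V, 2 ^ Fintype.card ι * Real.exp H := by
          gcongr with v hv
          refine (sum_signs_exp_le _).trans ?_
          gcongr
          have : ∑ i, (lam * v i) ^ 2 = lam ^ 2 * ∑ i, v i ^ 2 := by
            rw [Finset.mul_sum]; exact Finset.sum_congr rfl fun i _ => by ring
          rw [this]
          have h5 : lam ^ 2 * ∑ i, v i ^ 2 ≤ lam ^ 2 * r ^ 2 := by gcongr; exact hV v hv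
          have h6 : lam ^ 2 * r ^ 2 = 2 * H := by rw [← mul_pow, hlr, hs2]
          linarith
      _ = 2 ^ Fintype.card ι * (2 * H - 1) + Real.exp (-(2 * H)) *
          (V.card * (2 ^ Fintype.card ι * Real.exp H)) := by
          rw [Finset.sum_const, nsmul_eq_mul]
      _ ≤ 2 ^ Fintype.card ι * (2 * H - 1) + Real.exp (-(2 * H)) *
          (Real.exp H * (2 ^ Fintype.card ι * Real.exp H)) := by gcongr
      _ = 2 ^ Fintype.card ι * (2 * H) := by
          have : Real.exp (-(2 * H)) * (Real.exp H * Real.exp H) = 1 := by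
            rw [← Real.exp_add, ← Real.exp_add]; simp; ring
          linear_combination (2 ^ Fintype.card ι : ℝ) * this
  have h7 : lam * (2 ^ Fintype.card ι * (r * s)) = 2 ^ Fintype.card ι * (2 * H) := by
    rw [← hs2, ← hlr]; ring
  exact le_of_mul_le_mul_left (hsum.trans h7.symm.le) hlam0

/-- Chaining along finite nets `S k` at the scales `ε k`, for the supremum of a Rademacher sum over
a set `B` of vectors. -/
theorem sum_signs_sSup_le_chaining {ι : Type*} [Fintype ι] [DecidableEq ι] (B : Set (ι → ℝ))
    (hB : B.Nonempty) (S : ℕ → Finset (ι → ℝ)) (ε H : ℕ → ℝ) (hε : ∀ k, 0 < ε k)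
    (hH : ∀ k, 0 < H k) (v₀ : ι → ℝ) (hS₀ : S 0 = {v₀})
    (hcover : ∀ k, ∀ b ∈ B, ∃ p ∈ S k, ∀ i, |b i - p i| ≤ ε k)
    (hcard : ∀ k, ((S k).card : ℝ) * (S (k + 1)).card ≤ Real.exp (H k)) (hι : Nonempty ι) (K : ℕ) :
    ∑ σ : ι → ℤˣ, sSup ((fun b : ι → ℝ => ∑ i, ((σ i : ℤ) : ℝ) * b i) '' B)
      ≤ 2 ^ Fintype.card ι * (∑ k ∈ Finset.range K,
          Real.sqrt (Fintype.card ι) * (ε k + ε (k + 1)) * Real.sqrt (2 * H k)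
          + Fintype.card ι * ε K) := by
  classical
  -- Links join only nearby centers, so each link vector has Euclidean norm at most `√N (ε k + ε
  -- (k+1))`, while their number is still at most the product of the two net sizes.
  let P : ℕ → Finset ((ι → ℝ) × (ι → ℝ)) := fun k =>
    (S k ×ˢ S (k + 1)).filter fun p => ∀ i, |p.2 i - p.1 i| ≤ ε k + ε (k + 1)
  let V : ℕ → Finset (ι → ℝ) := fun k => (P k).image fun p => p.2 - p.1
  choose! π hπ hπε using hcover
  have hmem : ∀ k, ∀ b ∈ B, π (k + 1) b - π k b ∈ V k := by
    intro k b hb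
    refine Finset.mem_image.2 ⟨(π k b, π (k + 1) b), ?_, rfl⟩
    refine Finset.mem_filter.2 ⟨Finset.mem_product.2 ⟨hπ k b hb, hπ (k + 1) b hb⟩, fun i => ?_⟩
    have h1 := hπε k b hb i
    have h2 := hπε (k + 1) b hb i
    rw [abs_le] at *
    constructor <;> dsimp only <;> linarith
  obtain ⟨b₀, hb₀⟩ := hB
  have hVne : ∀ k, (V k).Nonempty := fun k => ⟨_, hmem k b₀ hb₀⟩
  let X : (ι → ℤˣ) → (ι → ℝ) → ℝ := fun σ b => ∑ i, ((σ i : ℤ) : ℝ) * b i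
  have hXsub : ∀ σ b c, X σ (b - c) = X σ b - X σ c := by
    intro σ b c
    simp only [X, Pi.sub_apply, mul_sub, Finset.sum_sub_distrib]
  let m : ℕ → (ι → ℤˣ) → ℝ := fun k σ => (V k).sup' (hVne k) (X σ)
  have hm : ∀ k, ∑ σ, m k σ ≤ 2 ^ Fintype.card ι *
      (Real.sqrt (Fintype.card ι) * (ε k + ε (k + 1)) * Real.sqrt (2 * H k)) := by
    intro k
    have hN : (0 : ℝ) < Fintype.card ι := by exact_mod_cast Fintype.card_pos
    have hεk := hε k
    have hεk' := hε (k + 1)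
    refine sum_signs_le_of_finite (V k) (by positivity) (hH k) ?_ ?_ (m k) ?_
    · refine le_trans ?_ (hcard k)
      rw [← Nat.cast_mul, ← Finset.card_product]
      exact_mod_cast Finset.card_image_le.trans (Finset.card_filter_le _ _)
    · intro v hv
      obtain ⟨p, hp, rfl⟩ := Finset.mem_image.1 hv
      have hp' := (Finset.mem_filter.1 hp).2
      calc ∑ i, (p.2 - p.1) i ^ 2 ≤ ∑ _i : ι, (ε k + ε (k + 1)) ^ 2 := by
            refine Finset.sum_le_sum fun i _ => ?_
            rw [← sq_abs]
            exact pow_le_pow_left₀ (abs_nonneg _) (hp' i) 2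
        _ = _ := by
            rw [Finset.sum_const, Finset.card_univ, nsmul_eq_mul, mul_pow, Real.sq_sqrt hN.le]
    · intro σ
      obtain ⟨v, hv, h⟩ := Finset.exists_mem_eq_sup' (hVne k) (X σ)
      exact ⟨v, hv, h.le⟩
  -- Telescoping along the centers `π k b`. The root `v₀` does not depend on `b`, so its term
  -- vanishes on averaging over signs.
  have hchain : ∀ σ, ∀ b ∈ B, ∀ K, X σ (π K b) ≤ X σ v₀ + ∑ k ∈ Finset.range K, m k σ := by
    intro σ b hb K
    induction K with
    | zero =>
      have := hπ 0 b hb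
      rw [hS₀, Finset.mem_singleton] at this
      simp [this]
    | succ K ih =>
      rw [Finset.sum_range_succ]
      have h1 : X σ (π (K + 1) b - π K b) ≤ m K σ := Finset.le_sup' (X σ) (hmem K b hb)
      rw [hXsub] at h1
      linarith
  have habs : ∀ σ : ι → ℤˣ, ∀ i, |((σ i : ℤ) : ℝ)| = 1 := by
    intro σ i
    rcases Int.units_eq_one_or (σ i) with h | h <;> simp [h]
  have hsup : ∀ σ : ι → ℤˣ, sSup (X σ '' B)
      ≤ X σ v₀ + ∑ k ∈ Finset.range K, m k σ + Fintype.card ι * ε K := by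
    intro σ
    refine csSup_le ⟨_, b₀, hb₀, rfl⟩ ?_
    rintro _ ⟨b, hb, rfl⟩
    have h1 := hchain σ b hb K
    have h2 : X σ (b - π K b) ≤ Fintype.card ι * ε K := by
      calc X σ (b - π K b) ≤ ∑ _i : ι, ε K := by
            refine Finset.sum_le_sum fun i _ => (le_abs_self _).trans ?_
            rw [abs_mul, habs, one_mul]
            exact hπε K b hb i
        _ = _ := by rw [Finset.sum_const, Finset.card_univ, nsmul_eq_mul]
    rw [hXsub] at h2
    linarith
  calc ∑ σ : ι → ℤˣ, sSup (X σ '' B)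
      ≤ ∑ σ : ι → ℤˣ, (X σ v₀ + ∑ k ∈ Finset.range K, m k σ + Fintype.card ι * ε K) :=
        Finset.sum_le_sum fun σ _ => hsup σ
    _ = ∑ k ∈ Finset.range K, ∑ σ, m k σ + 2 ^ Fintype.card ι * (Fintype.card ι * ε K) := by
        rw [Finset.sum_add_distrib, Finset.sum_add_distrib, sum_signs_eq_zero, zero_add,
          Finset.sum_comm, Finset.sum_const, Finset.card_univ, nsmul_eq_mul]
        simp [Fintype.card_pi]
    _ ≤ ∑ k ∈ Finset.range K, 2 ^ Fintype.card ι *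
      (Real.sqrt (Fintype.card ι) * (ε k + ε (k + 1)) * Real.sqrt (2 * H k))
        + 2 ^ Fintype.card ι * (Fintype.card ι * ε K) := by
        gcongr with k _
        exact hm k
    _ = _ := by rw [← Finset.mul_sum]; ring

/-- Chaining for a set whose covering numbers grow like `9 ^ (3 A M / ε)`. -/
theorem sum_signs_sSup_le_of_entropy {ι : Type*} [Fintype ι] [DecidableEq ι] [Nonempty ι]
    (B : Set (ι → ℝ)) (hB : B.Nonempty) {M A : ℝ} (hM : 0 < M) (hA : 0 < A)
    (hbd : ∀ b ∈ B, ∀ i, |b i| ≤ M)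
    (hcover : ∀ ε : ℝ, 0 < ε → ∃ S : Finset (ι → ℝ), S.card ≤ 9 ^ ⌊3 * A * M / ε⌋₊ ∧
      ∀ b ∈ B, ∃ p ∈ S, ∀ i, |b i - p i| ≤ ε) :
    ∑ σ : ι → ℤˣ, sSup ((fun b : ι → ℝ => ∑ i, ((σ i : ℤ) : ℝ) * b i) '' B)
      ≤ 2 ^ Fintype.card ι * (60 * M * Real.sqrt (Fintype.card ι * A)) := by
  choose! S₁ hS₁ hS₁c using hcover
  -- Scales shrink by 4 while the root of the entropy grows by 2, so the chaining terms decay like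
  -- `2^{-k}`. At `k = 0` the single center `0` suffices because `|b i| ≤ M`.
  let ε : ℕ → ℝ := fun k => 2 * M / 4 ^ k
  let S : ℕ → Finset (ι → ℝ) := fun k => if k = 0 then {0} else S₁ (ε k)
  -- Since `9 ≤ exp 8`, the net at level `k` has log-size at most `12 A 4^k`; two consecutive levels
  -- give `12 + 48 = 60`.
  let H : ℕ → ℝ := fun k => 60 * A * 4 ^ k
  have hε : ∀ k, 0 < ε k := fun k => by positivity
  have hScard : ∀ k, ((S k).card : ℝ) ≤ Real.exp (12 * A * 4 ^ k) := by
    intro k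
    rcases Nat.eq_zero_or_pos k with rfl | hk
    · simp only [S, if_true, Finset.card_singleton, Nat.cast_one]
      exact Real.one_le_exp (by positivity)
    · simp only [S, hk.ne', if_false]
      have h1 : ((S₁ (ε k)).card : ℝ) ≤ 9 ^ ⌊3 * A * M / ε k⌋₊ := by
        exact_mod_cast hS₁ (ε k) (hε k)
      refine h1.trans ?_
      have h9 : (9 : ℝ) ≤ Real.exp 8 := by
        have := Real.add_one_le_exp (8 : ℝ); linarith
      calc (9 : ℝ) ^ ⌊3 * A * M / ε k⌋₊ ≤ Real.exp 8 ^ ⌊3 * A * M / ε k⌋₊ := by gcongr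
        _ = Real.exp (⌊3 * A * M / ε k⌋₊ * 8) := (Real.exp_nat_mul _ _).symm
        _ ≤ Real.exp (12 * A * 4 ^ k) := by
          apply Real.exp_le_exp.2
          have h2 : (⌊3 * A * M / ε k⌋₊ : ℝ) ≤ 3 * A * M / ε k :=
            Nat.floor_le (by have := hε k; positivity)
          have h3 : 3 * A * M / ε k = 3 / 2 * A * 4 ^ k := by
            simp only [ε]; field_simp
          linarith
  have key : ∀ K : ℕ, ∑ σ : ι → ℤˣ, sSup ((fun b : ι → ℝ => ∑ i, ((σ i : ℤ) : ℝ) * b i) '' B)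
      ≤ 2 ^ Fintype.card ι * (60 * M * Real.sqrt (Fintype.card ι * A)
        + Fintype.card ι * (2 * M * (1 / 4) ^ K)) := by
    intro K
    refine (sum_signs_sSup_le_chaining B hB S ε H hε (fun k => by positivity) 0 (by simp [S])
      ?_ ?_ inferInstance K).trans ?_
    · intro k b hb
      rcases Nat.eq_zero_or_pos k with rfl | hk
      · refine ⟨0, by simp [S], fun i => ?_⟩
        have := hbd b hb i
        simp only [Pi.zero_apply, sub_zero, ε, pow_zero, div_one]
        linarith
      · simp only [S, hk.ne', if_false]
        exact hS₁c (ε k) (hε k) b hb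
    · intro k
      refine (mul_le_mul (hScard k) (hScard (k + 1)) (by positivity) (Real.exp_pos _).le).trans ?_
      rw [← Real.exp_add]
      apply Real.exp_le_exp.2
      simp only [H, pow_succ]
      linarith
    -- Constants: `120 ≤ 11²` and `11 · 5/2 ≤ 30`; the geometric series then doubles `30` to `60`.
    · have hterm : ∀ k, Real.sqrt (Fintype.card ι) * (ε k + ε (k + 1)) * Real.sqrt (2 * H k)
          ≤ 30 * M * Real.sqrt (Fintype.card ι * A) * (1 / 2) ^ k := by
        intro k
        have h4 : Real.sqrt (2 * H k) ≤ 11 * Real.sqrt A * 2 ^ k := by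
          apply Real.sqrt_le_iff.2 ⟨by positivity, ?_⟩
          rw [mul_pow, mul_pow, Real.sq_sqrt hA.le, ← pow_mul, mul_comm k 2, pow_mul]
          simp only [H]
          have : 0 ≤ A * 4 ^ k := by positivity
          norm_num
          linarith
        have h5 : ε k + ε (k + 1) = 5 / 2 * M * ((1 / 2) ^ k * (1 / 2) ^ k) := by
          have h6 : ((1 : ℝ) / 2) ^ k * (1 / 2) ^ k = 1 / 4 ^ k := by
            rw [← mul_pow, ← one_div_pow]; norm_num
          rw [h6]
          simp only [ε, pow_succ]
          field_simp
          norm_num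
        rw [Real.sqrt_mul (Nat.cast_nonneg (Fintype.card ι)) A, h5]
        calc Real.sqrt (Fintype.card ι) * (5 / 2 * M * ((1 / 2) ^ k * (1 / 2) ^ k))
              * Real.sqrt (2 * H k)
            ≤ Real.sqrt (Fintype.card ι) * (5 / 2 * M * ((1 / 2) ^ k * (1 / 2) ^ k))
              * (11 * Real.sqrt A * 2 ^ k) := by gcongr
          _ = 55 / 2 * M * (Real.sqrt (Fintype.card ι) * Real.sqrt A) * (1 / 2) ^ k
              * ((1 / 2) ^ k * 2 ^ k) := by ring
          _ ≤ _ := by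
            have h7 : ((1 : ℝ) / 2) ^ k * 2 ^ k = 1 := by rw [← mul_pow]; norm_num
            rw [h7, mul_one]
            gcongr
            norm_num
      have hgeom : ∑ k ∈ Finset.range K, ((1 : ℝ) / 2) ^ k ≤ 2 := by
        have := sum_geometric_two_le K
        exact this
      gcongr
      · calc _ ≤ ∑ k ∈ Finset.range K,
              30 * M * Real.sqrt (Fintype.card ι * A) * (1 / 2) ^ k :=
              Finset.sum_le_sum fun k _ => hterm k
          _ = 30 * M * Real.sqrt (Fintype.card ι * A) * ∑ k ∈ Finset.range K, (1 / 2) ^ k :=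
              (Finset.mul_sum _ _ _).symm
          _ ≤ 30 * M * Real.sqrt (Fintype.card ι * A) * 2 := by gcongr
          _ = _ := by ring
      · simp only [ε, one_div, inv_pow]
        exact le_of_eq (div_eq_mul_inv _ _)
  -- The entropy sum converges, so the chain can be continued to scale zero and the remainder
  -- disappears.
  have hlim : Filter.Tendsto (fun K : ℕ => (2 : ℝ) ^ Fintype.card ι *
      (60 * M * Real.sqrt (Fintype.card ι * A) + Fintype.card ι * (2 * M * (1 / 4) ^ K)))
      Filter.atTop (nhds (2 ^ Fintype.card ι *
      (60 * M * Real.sqrt (Fintype.card ι * A) + Fintype.card ι * (2 * M * 0)))) := by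
    refine Filter.Tendsto.const_mul _ (Filter.Tendsto.const_add _ (Filter.Tendsto.const_mul _
      (Filter.Tendsto.const_mul _ ?_)))
    exact tendsto_pow_atTop_nhds_zero_of_lt_one (by norm_num) (by norm_num)
  have := ge_of_tendsto' hlim key
  simpa using this

/-! ### Entropy of the Lipschitz nonlinearities. -/

theorem neg_mem_of_comp_neg {M L : ℝ} {F : ℝ → ℝ} (hF : F ∈ nonlinearityClass M L) :
    (fun x => F (-x)) ∈ nonlinearityClass M L := by
  refine ⟨by simpa using hF.1, fun s hs r hr => ?_⟩
  have := hF.2 (-s) ⟨by linarith [hs.2], by linarith [hs.1]⟩ (-r)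
    ⟨by linarith [hr.2], by linarith [hr.1]⟩
  rwa [neg_sub_neg, abs_sub_comm r s] at this

/-- The increments of `F`, rounded down to multiples of `η`, along the grid `j h`, `j = 0, …, J`. -/
noncomputable def gridCode (η h : ℝ) (J : ℕ) (F : ℝ → ℝ) : Fin J → ℤ :=
  fun j => ⌊F (((j : ℕ) + 1 : ℝ) * h) / η⌋ - ⌊F (((j : ℕ) : ℝ) * h) / η⌋

/-- Over one grid step `F / η` moves by at most one, hence so does its floor: three possible
increments. -/
theorem gridCode_mem {M L η h : ℝ} (hη : 0 < η) (hh : 0 < h) (hLh : L * h ≤ η) {J : ℕ}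
    (hJ : J * h ≤ M) {F : ℝ → ℝ} (hF : F ∈ nonlinearityClass M L) (j : Fin J) :
    gridCode η h J F j ∈ Finset.Icc (-1 : ℤ) 1 := by
  have hj : ((j : ℕ) + 1 : ℝ) ≤ J := by exact_mod_cast j.2
  have hj0 : (0 : ℝ) ≤ ((j : ℕ) : ℝ) * h := by positivity
  have hj1 : ((j : ℕ) + 1 : ℝ) * h ≤ J * h := by gcongr
  have h1 := hF.2 (((j : ℕ) + 1 : ℝ) * h) ⟨by linarith, by linarith⟩ (((j : ℕ) : ℝ) * h)
    ⟨by linarith, by linarith⟩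
  have h2 : ((j : ℕ) + 1 : ℝ) * h - ((j : ℕ) : ℝ) * h = h := by ring
  rw [h2, abs_of_pos hh] at h1
  have h3 : |F (((j : ℕ) + 1 : ℝ) * h) / η - F (((j : ℕ) : ℝ) * h) / η| ≤ 1 := by
    rw [← sub_div, abs_div, abs_of_pos hη, div_le_one hη]
    linarith
  rw [abs_le] at h3
  rw [Finset.mem_Icc, gridCode]
  constructor
  · have : ⌊F (((j : ℕ) : ℝ) * h) / η⌋ ≤ ⌊F (((j : ℕ) + 1 : ℝ) * h) / η + 1⌋ :=
      Int.floor_le_floor (by linarith)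
    rw [Int.floor_add_one] at this
    omega
  · have : ⌊F (((j : ℕ) + 1 : ℝ) * h) / η⌋ ≤ ⌊F (((j : ℕ) : ℝ) * h) / η + 1⌋ :=
      Int.floor_le_floor (by linarith)
    rw [Int.floor_add_one] at this
    omega

/-- The increments telescope from the common value `F 0 = G 0 = 0`, so no starting value needs to be
encoded. -/
theorem floor_eq_of_gridCode_eq {η h : ℝ} {J : ℕ} {F G : ℝ → ℝ} (hF : F 0 = 0) (hG : G 0 = 0)
    (hc : gridCode η h J F = gridCode η h J G) (j : ℕ) (hj : j ≤ J) :
    ⌊F ((j : ℝ) * h) / η⌋ = ⌊G ((j : ℝ) * h) / η⌋ := by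
  induction j with
  | zero => simp [hF, hG]
  | succ j ih =>
    have h1 := ih (by omega)
    have h2 := congrFun hc ⟨j, by omega⟩
    simp only [gridCode] at h2
    push_cast
    omega

/-- One `η` comes from equal floors at the grid point to the left of `x`, and one from the variation
of each function between that point and `x`. -/
theorem abs_sub_le_of_gridCode_eq {M L η : ℝ} (hM : 0 < M) (hL : 0 < L) (hη : 0 < η)
    {F G : ℝ → ℝ} (hF : F ∈ nonlinearityClass M L) (hG : G ∈ nonlinearityClass M L)
    (hc : gridCode η (η / L) ⌊M * L / η⌋₊ F = gridCode η (η / L) ⌊M * L / η⌋₊ G)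
    {x : ℝ} (hx : x ∈ Set.Icc 0 M) : |F x - G x| ≤ 3 * η := by
  have hh : 0 < η / L := div_pos hη hL
  set j := ⌊x / (η / L)⌋₊ with hj
  have hML : M * L / η = M / (η / L) := by field_simp
  have hjJ : j ≤ ⌊M * L / η⌋₊ := by
    rw [hML]
    exact Nat.floor_le_floor (div_le_div_of_nonneg_right hx.2 hh.le)
  have hjx : (j : ℝ) * (η / L) ≤ x :=
    (le_div_iff₀ hh).1 (Nat.floor_le (div_nonneg hx.1 hh.le))
  have hxj : x < (j + 1 : ℝ) * (η / L) := (div_lt_iff₀ hh).1 (Nat.lt_floor_add_one _)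
  have hj0 : (0 : ℝ) ≤ (j : ℝ) * (η / L) := by positivity
  have hfl := Int.abs_sub_lt_one_of_floor_eq_floor (floor_eq_of_gridCode_eq hF.1 hG.1 hc j hjJ)
  rw [← sub_div, abs_div, abs_of_pos hη, div_lt_one hη] at hfl
  have hxI : x ∈ Set.Icc (-M) M := ⟨by linarith [hx.1], hx.2⟩
  have hjI : (j : ℝ) * (η / L) ∈ Set.Icc (-M) M := ⟨by linarith, by linarith [hx.2]⟩
  have hd : L * |x - j * (η / L)| ≤ η := by
    rw [abs_of_nonneg (by linarith)]
    calc L * (x - j * (η / L)) ≤ L * (η / L) := by gcongr; linarith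
      _ = η := by field_simp
  have h1 := (hF.2 x hxI _ hjI).trans hd
  have h2 := (hG.2 x hxI _ hjI).trans hd
  rw [abs_le] at *
  constructor <;> linarith [(abs_lt.1 hfl).1, (abs_lt.1 hfl).2]

/-- One representative per attained code. The net lies inside `s`, so its members can themselves
drive the Picard iteration. -/
theorem exists_net_of_code {α β : Type*} [DecidableEq β] (s : Set α) (c : α → β) (T : Finset β)
    (hc : ∀ a ∈ s, c a ∈ T) :
    ∃ P : Finset α, ↑P ⊆ s ∧ P.card ≤ T.card ∧ ∀ a ∈ s, ∃ p ∈ P, c a = c p := by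
  obtain ⟨s', hs', hbij⟩ := Set.exists_subset_bijOn s c
  have himg : c '' s ⊆ ↑T := by rintro _ ⟨a, ha, rfl⟩; exact hc a ha
  have hfin : s'.Finite := hbij.finite_iff_finite.2 (T.finite_toSet.subset himg)
  refine ⟨hfin.toFinset, by simpa using hs', ?_, fun a ha => ?_⟩
  · refine Finset.card_le_card_of_injOn c (fun a ha => hc a (hs' (by simpa using ha))) ?_
    simpa using hbij.injOn
  · obtain ⟨p, hp, h⟩ := hbij.surjOn ⟨a, ha, rfl⟩
    exact ⟨p, by simpa using hp, h.symm⟩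

/-- The Kolmogorov entropy bound for Lipschitz functions on an interval. -/
theorem exists_net_nonlinearityClass {M L η : ℝ} (hM : 0 < M) (hL : 0 < L) (hη : 0 < η) :
    ∃ P : Finset (ℝ → ℝ), ↑P ⊆ nonlinearityClass M L ∧ P.card ≤ 9 ^ ⌊M * L / η⌋₊ ∧
      ∀ F ∈ nonlinearityClass M L, ∃ G ∈ P, ∀ x ∈ Set.Icc (-M) M, |F x - G x| ≤ 3 * η := by
  classical
  set J := ⌊M * L / η⌋₊ with hJ
  have hh : 0 < η / L := div_pos hη hL
  have hJh : J * (η / L) ≤ M := by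
    have : (J : ℝ) ≤ M * L / η := Nat.floor_le (by positivity)
    calc J * (η / L) ≤ M * L / η * (η / L) := by gcongr
      _ = M := by field_simp
  have hLh : L * (η / L) ≤ η := by rw [mul_div_cancel₀ _ hL.ne']
  -- Both half-intervals are encoded, the left one by reflection, which gives `3 · 3 = 9`
  -- possibilities per grid step.
  let c : (ℝ → ℝ) → (Fin J → ℤ × ℤ) := fun F j =>
    (gridCode η (η / L) J F j, gridCode η (η / L) J (fun x => F (-x)) j)
  obtain ⟨P, hPs, hPc, hP⟩ := exists_net_of_code (nonlinearityClass M L) c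
    (Fintype.piFinset fun _ => Finset.Icc (-1 : ℤ) 1 ×ˢ Finset.Icc (-1 : ℤ) 1) (by
      intro F hF
      refine Fintype.mem_piFinset.2 fun j => Finset.mem_product.2 ⟨?_, ?_⟩
      · exact gridCode_mem hη hh hLh hJh hF j
      · exact gridCode_mem hη hh hLh hJh (neg_mem_of_comp_neg hF) j)
  refine ⟨P, hPs, by simpa using hPc, fun F hF => ?_⟩
  obtain ⟨G, hGP, hFG⟩ := hP F hF
  have hG := hPs hGP
  refine ⟨G, hGP, fun x hx => ?_⟩
  rcases le_total 0 x with h0 | h0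
  · exact abs_sub_le_of_gridCode_eq hM hL hη hF hG
      (funext fun j => congrArg Prod.fst (congrFun hFG j)) ⟨h0, hx.2⟩
  · have := abs_sub_le_of_gridCode_eq hM hL hη (neg_mem_of_comp_neg hF) (neg_mem_of_comp_neg hG)
      (funext fun j => congrArg Prod.snd (congrFun hFG j)) (x := -x)
      ⟨by linarith, by linarith [hx.1]⟩
    simpa using this

/-! ### The heat kernel of the torus. -/

theorem hasSum_pi_prod (d : ℕ) (f : Fin d → ℤ → ℂ) (hf : ∀ i, Summable fun k => ‖f i k‖) :
    (Summable fun ξ : Fin d → ℤ => ‖∏ i, f i (ξ i)‖) ∧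
      HasSum (fun ξ : Fin d → ℤ => ∏ i, f i (ξ i)) (∏ i, ∑' k, f i k) := by
  induction d with
  | zero =>
    refine ⟨(hasSum_fintype _).summable, ?_⟩
    simp
  | succ d ih =>
    obtain ⟨h1, h2⟩ := ih (fun i => f i.succ) fun i => hf i.succ
    have h3 := (hf 0).mul_norm h1
    constructor
    · rw [← (Fin.consEquiv fun _ => ℤ).summable_iff]
      refine h3.congr fun p => ?_
      simp [Function.comp, Fin.consEquiv, Fin.prod_univ_succ]
    · rw [← (Fin.consEquiv fun _ => ℤ).hasSum_iff, Fin.prod_univ_succ]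
      have h4 := h3.of_norm
      have h5 := (hf 0).of_norm.hasSum.mul h2 h4
      refine h5.congr_fun fun p => ?_
      simp [Function.comp, Fin.consEquiv, Fin.prod_univ_succ]

theorem summable_exp_neg_mul_sq {t : ℝ} (ht : 0 < t) :
    Summable fun n : ℤ => Real.exp (-t * (n : ℝ) ^ 2) := by
  have h := (HurwitzZeta.hasSum_int_evenKernel 0 (t := t / Real.pi) (by positivity)).summable
  refine h.congr fun n => ?_
  congr 1
  field_simp
  simp

/-- The heat kernel `∑_n e^{-tn²} e^{inx}` of the circle, up to the factor `2π`. -/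
noncomputable def circleKernel (t : ℝ) (x : AddCircle (2 * Real.pi)) : ℂ :=
  ∑' n : ℤ, (Real.exp (-t * (n : ℝ) ^ 2) : ℂ) * fourier n x

theorem norm_circleKernel_term (t : ℝ) (x : AddCircle (2 * Real.pi)) (n : ℤ) :
    ‖(Real.exp (-t * (n : ℝ) ^ 2) : ℂ) * fourier n x‖ = Real.exp (-t * (n : ℝ) ^ 2) := by
  rw [norm_mul, Complex.norm_real, Real.norm_of_nonneg (Real.exp_pos _).le, fourier_apply,
    Circle.norm_coe, mul_one]

/-- Positivity of the heat kernel of the circle, from the functional equation of the theta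
function. -/
theorem exists_nonneg_circleKernel_eq {t : ℝ} (ht : 0 < t) (x : AddCircle (2 * Real.pi)) :
    ∃ r : ℝ, 0 ≤ r ∧ circleKernel t x = r := by
  induction x using QuotientAddGroup.induction_on with
  | H x =>
    have hs : 0 < t / Real.pi := by positivity
    refine ⟨HurwitzZeta.cosKernel ((x / (2 * Real.pi) : ℝ) : UnitAddCircle) (t / Real.pi), ?_, ?_⟩
    -- The functional equation makes the cosine series at `t / π` a positive multiple of a series of
    -- Gaussians at `π / t`, whose terms are visibly positive.
    · have h := HurwitzZeta.evenKernel_functional_equation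
        ((x / (2 * Real.pi) : ℝ) : UnitAddCircle) (Real.pi / t)
      rw [one_div_div] at h
      have h0 : 0 ≤ HurwitzZeta.evenKernel ((x / (2 * Real.pi) : ℝ) : UnitAddCircle)
          (Real.pi / t) :=
        (HurwitzZeta.hasSum_int_evenKernel _ (by positivity)).nonneg fun n => (Real.exp_pos _).le
      rw [h] at h0
      exact nonneg_of_mul_nonneg_right h0 (by positivity)
    · refine HasSum.tsum_eq ?_
      refine (HurwitzZeta.hasSum_int_cosKernel (x / (2 * Real.pi)) hs).congr_fun ?_
      intro n
      have := fourier_coe_apply (T := 2 * Real.pi) (n := n) (x := x)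
      rw [show (QuotientAddGroup.mk x : AddCircle (2 * Real.pi)) = (x : AddCircle (2 * Real.pi))
        from rfl, this, mul_comm]
      congr 1
      · congr 1; push_cast; field_simp
      · congr 2; field_simp

theorem measurable_circleKernel :
    Measurable fun p : ℝ × AddCircle (2 * Real.pi) => circleKernel p.1 p.2 := by
  refine Measurable.tsum fun n => ?_
  have : Measurable fun x : AddCircle (2 * Real.pi) => fourier n x := (fourier n).continuous.measurable
  exact Measurable.mul (by fun_prop) (this.comp measurable_snd)

theorem integral_fourier (n : ℤ) :
    ∫ x : AddCircle (2 * Real.pi), fourier n x = if n = 0 then ((2 * Real.pi : ℝ) : ℂ) else 0 := by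
  have h := congrFun (fourierCoeff_fourier (T := 2 * Real.pi) n) 0
  rw [fourierCoeff, AddCircle.integral_haarAddCircle] at h
  simp only [neg_zero, fourier_zero, one_smul, Pi.single_apply] at h
  have hpi : (2 * Real.pi) ≠ 0 := by positivity
  have h2 := congrArg (fun z : ℂ => (2 * Real.pi) • z) h
  simp only [smul_inv_smul₀ hpi] at h2
  rw [h2]
  by_cases hn : n = 0
  · simp [hn]
  · simp [hn, Ne.symm hn]

theorem integral_circleKernel {t : ℝ} (ht : 0 < t) :
    ∫ x, circleKernel t x = ((2 * Real.pi : ℝ) : ℂ) := by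
  unfold circleKernel
  rw [← MeasureTheory.integral_tsum_of_summable_integral_norm]
  · rw [tsum_eq_single 0]
    · rw [MeasureTheory.integral_const_mul, integral_fourier]; simp
    · intro n hn
      rw [MeasureTheory.integral_const_mul, integral_fourier]; simp [hn]
  · intro n
    exact ((fourier n).continuous.const_mul _).integrable_of_hasCompactSupport
      (HasCompactSupport.of_compactSpace _)
  · simp_rw [norm_circleKernel_term, MeasureTheory.integral_const]
    exact (summable_exp_neg_mul_sq ht).const_smul _

/-- The heat kernel of the torus. -/
noncomputable def torusKernel {d : ℕ} (t : ℝ) (x : Torus d) : ℝ :=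
  ∏ i, ((2 * Real.pi)⁻¹ * (circleKernel t (x i)).re)

theorem torusKernel_nonneg {d : ℕ} {t : ℝ} (ht : 0 < t) (x : Torus d) : 0 ≤ torusKernel t x := by
  refine Finset.prod_nonneg fun i _ => mul_nonneg (by positivity) ?_
  obtain ⟨r, hr, h⟩ := exists_nonneg_circleKernel_eq ht (x i)
  simpa [h] using hr

theorem measurable_torusKernel {d : ℕ} :
    Measurable fun p : ℝ × Torus d => torusKernel p.1 p.2 := by
  refine Finset.measurable_prod _ fun i _ => Measurable.const_mul ?_ _
  exact Complex.measurable_re.comp (measurable_circleKernel.comp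
    (measurable_fst.prodMk ((measurable_pi_apply i).comp measurable_snd)))

theorem integral_torusKernel {d : ℕ} {t : ℝ} (ht : 0 < t) : ∫ x : Torus d, torusKernel t x = 1 := by
  unfold torusKernel
  rw [MeasureTheory.integral_fintype_prod_volume_eq_prod
    (f := fun _ (x : AddCircle (2 * Real.pi)) => (2 * Real.pi)⁻¹ * (circleKernel t x).re)]
  refine Finset.prod_eq_one fun i _ => ?_
  have h : ∀ x, circleKernel t x = ((circleKernel t x).re : ℂ) := by
    intro x
    obtain ⟨r, _, h⟩ := exists_nonneg_circleKernel_eq ht x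
    simp [h]
  have h2 := integral_circleKernel ht
  rw [MeasureTheory.integral_congr_ae (Filter.Eventually.of_forall h),
    integral_complex_ofReal] at h2
  rw [MeasureTheory.integral_const_mul, Complex.ofReal_injective h2]
  exact inv_mul_cancel₀ (by positivity)

theorem integrable_torusKernel {d : ℕ} {t : ℝ} (ht : 0 < t) :
    MeasureTheory.Integrable fun x : Torus d => torusKernel t x := by
  -- A nonintegrable function has integral `0` by convention, contradicting total mass one.
  by_contra h
  have := MeasureTheory.integral_undef h
  rw [integral_torusKernel ht] at this
  exact one_ne_zero this

theorem norm_fourierMode {d : ℕ} (ξ : Fin d → ℤ) (x : Torus d) :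
    ‖fourierMode ξ x‖ = (2 * Real.pi) ^ (-(d : ℝ) / 2) := by
  rw [fourierMode, norm_mul, Complex.norm_real, Real.norm_of_nonneg (by positivity), norm_prod]
  simp only [fourier_apply, Circle.norm_coe, Finset.prod_const_one, mul_one]

theorem continuous_fourierMode {d : ℕ} (ξ : Fin d → ℤ) :
    Continuous (fourierMode ξ : Torus d → ℂ) := by
  unfold fourierMode
  exact continuous_const.mul (continuous_finsetProd _ fun i _ =>
    (fourier (ξ i)).continuous.comp (continuous_apply i))

theorem fourier_sub_apply {T : ℝ} (n : ℤ) (x y : AddCircle T) :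
    fourier n (x - y) = fourier n x * conj (fourier n y) := by
  rw [← fourier_neg, fourier_apply, fourier_apply, fourier_apply, ← Circle.coe_mul,
    ← AddCircle.toCircle_add]
  congr 2
  rw [zsmul_sub, neg_smul, sub_eq_add_neg]

theorem fourierMode_mul_conj {d : ℕ} (ξ : Fin d → ℤ) (x y : Torus d) :
    fourierMode ξ x * conj (fourierMode ξ y)
      = ∏ i, (((2 * Real.pi)⁻¹ : ℝ) : ℂ) * fourier (ξ i) ((x - y) i) := by
  have hc : (((2 * Real.pi) ^ (-(d : ℝ) / 2) : ℝ) : ℂ) * (((2 * Real.pi) ^ (-(d : ℝ) / 2) : ℝ) : ℂ)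
      = (((2 * Real.pi)⁻¹ : ℝ) : ℂ) ^ d := by
    rw [← Complex.ofReal_mul, ← Complex.ofReal_pow, ← Real.rpow_add (by positivity), inv_pow,
      ← Real.rpow_natCast, ← Real.rpow_neg (by positivity)]
    congr 2; ring
  simp only [fourierMode, map_mul, Complex.conj_ofReal, map_prod, Pi.sub_apply, fourier_sub_apply,
    Finset.prod_mul_distrib, Finset.prod_const, Finset.card_univ, Fintype.card_fin]
  rw [← hc]; ring

theorem hasSum_torusKernel {d : ℕ} {t : ℝ} (ht : 0 < t) (x y : Torus d) :
    HasSum (fun ξ : Fin d → ℤ => (Real.exp (-t * ∑ i, (ξ i : ℝ) ^ 2) : ℂ) *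
      (fourierMode ξ x * conj (fourierMode ξ y))) (torusKernel t (x - y) : ℂ) := by
  have h := (hasSum_pi_prod d (fun i n => (((2 * Real.pi)⁻¹ : ℝ) : ℂ) *
    ((Real.exp (-t * (n : ℝ) ^ 2) : ℂ) * fourier n ((x - y) i))) (fun i => by
      simp_rw [norm_mul _ (_ * _), norm_circleKernel_term]
      exact (summable_exp_neg_mul_sq ht).mul_left _)).2
  have hre : ∏ i, ∑' n : ℤ, (((2 * Real.pi)⁻¹ : ℝ) : ℂ) *
      ((Real.exp (-t * (n : ℝ) ^ 2) : ℂ) * fourier n ((x - y) i)) = (torusKernel t (x - y) : ℂ) := by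
    rw [torusKernel, Complex.ofReal_prod]
    refine Finset.prod_congr rfl fun i _ => ?_
    obtain ⟨r, _, hr⟩ := exists_nonneg_circleKernel_eq ht ((x - y) i)
    rw [tsum_mul_left, Complex.ofReal_mul, hr, Complex.ofReal_re, ← hr, circleKernel]
  rw [hre] at h
  refine h.congr_fun fun ξ => ?_
  rw [fourierMode_mul_conj, Finset.mul_sum, Real.exp_sum, Complex.ofReal_prod,
    ← Finset.prod_mul_distrib]
  exact Finset.prod_congr rfl fun i _ => by ring

theorem summable_exp_neg_mul_sum_sq (d : ℕ) {t : ℝ} (ht : 0 < t) :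
    Summable fun ξ : Fin d → ℤ => Real.exp (-t * ∑ i, (ξ i : ℝ) ^ 2) := by
  have h := (hasSum_pi_prod d (fun _ n => (Real.exp (-t * (n : ℝ) ^ 2) : ℂ)) (fun i => by
    simpa only [Complex.norm_real, Real.norm_of_nonneg (Real.exp_pos _).le] using
      summable_exp_neg_mul_sq ht)).1
  refine h.congr fun ξ => ?_
  rw [← Complex.ofReal_prod, ← Real.exp_sum, ← Finset.mul_sum, Complex.norm_real,
    Real.norm_of_nonneg (Real.exp_pos _).le]

/-- The heat semigroup is convolution with the heat kernel. -/
theorem heatSemigroup_eq_integral {d : ℕ} {t : ℝ} (ht : 0 < t) {f : Torus d → ℝ}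
    (hf : Measurable f) {c : ℝ} (hc : ∀ x, |f x| ≤ c) (x : Torus d) :
    heatSemigroup t f x = ∫ y, torusKernel t (x - y) * f y := by
  have hfi : ∀ ξ : Fin d → ℤ, MeasureTheory.Integrable
      fun y => (f y : ℂ) * ((Real.exp (-t * ∑ i, (ξ i : ℝ) ^ 2) : ℂ) *
      (fourierMode ξ x * conj (fourierMode ξ y))) := by
    intro ξ
    refine MeasureTheory.Integrable.bdd_mul (c := c) ?_ ?_ ?_
    · refine Continuous.integrable_of_hasCompactSupport ?_ (HasCompactSupport.of_compactSpace _)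
      exact continuous_const.mul (continuous_const.mul
        (Complex.continuous_conj.comp (continuous_fourierMode ξ)))
    · exact (Complex.measurable_ofReal.comp hf).aestronglyMeasurable
    · exact Filter.Eventually.of_forall fun y => by simpa using hc y
  have hnorm : ∀ ξ : Fin d → ℤ, ∀ y, ‖(f y : ℂ) * ((Real.exp (-t * ∑ i, (ξ i : ℝ) ^ 2) : ℂ) *
      (fourierMode ξ x * conj (fourierMode ξ y)))‖ ≤ c * (Real.exp (-t * ∑ i, (ξ i : ℝ) ^ 2) *
        ((2 * Real.pi) ^ (-(d : ℝ) / 2) * (2 * Real.pi) ^ (-(d : ℝ) / 2))) := by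
    intro ξ y
    rw [norm_mul, norm_mul, norm_mul, RCLike.norm_conj, norm_fourierMode, norm_fourierMode,
      Complex.norm_real, Complex.norm_real, Real.norm_of_nonneg (Real.exp_pos _).le]
    gcongr
    exact hc y
  have hsum := MeasureTheory.integral_tsum_of_summable_integral_norm hfi (by
    refine Summable.of_nonneg_of_le (fun ξ => MeasureTheory.integral_nonneg fun y => norm_nonneg _)
      (fun ξ => ?_) ((((summable_exp_neg_mul_sum_sq d ht).mul_right
        ((2 * Real.pi) ^ (-(d : ℝ) / 2) * (2 * Real.pi) ^ (-(d : ℝ) / 2))).mul_left c).mul_left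
          (MeasureTheory.volume.real (Set.univ : Set (Torus d))))
    refine (MeasureTheory.integral_mono (hfi ξ).norm (MeasureTheory.integrable_const _)
      (hnorm ξ)).trans ?_
    rw [MeasureTheory.integral_const, smul_eq_mul])
  have hker : ∀ y, ∑' ξ : Fin d → ℤ, (f y : ℂ) * ((Real.exp (-t * ∑ i, (ξ i : ℝ) ^ 2) : ℂ) *
      (fourierMode ξ x * conj (fourierMode ξ y))) = ((torusKernel t (x - y) * f y : ℝ) : ℂ) := by
    intro y
    rw [tsum_mul_left, (hasSum_torusKernel ht x y).tsum_eq, mul_comm, Complex.ofReal_mul]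
  simp_rw [hker] at hsum
  rw [integral_complex_ofReal] at hsum
  rw [heatSemigroup, if_pos ht, ← Complex.ofReal_re (∫ y, torusKernel t (x - y) * f y), ← hsum]
  congr 2
  ext ξ
  rw [torusFourierCoeff, mul_right_comm, ← MeasureTheory.integral_const_mul]
  refine MeasureTheory.integral_congr_ae (Filter.Eventually.of_forall fun y => ?_)
  dsimp only
  ring

/-! ### Sup-norm contraction, linearity and measurability of the heat semigroup. -/

open MeasureTheory in
instance isNegInvariant_volume_addCircle :
    (volume : Measure (AddCircle (2 * Real.pi))).IsNegInvariant := inferInstance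

open MeasureTheory in
instance isNegInvariant_volume_torus (d : ℕ) : (volume : Measure (Torus d)).IsNegInvariant :=
  Measure.pi.isNegInvariant _

open MeasureTheory in
theorem integrable_torusKernel_mul {d : ℕ} {t : ℝ} (ht : 0 < t) {f : Torus d → ℝ}
    (hf : Measurable f) {c : ℝ} (hc : ∀ x, |f x| ≤ c) (x : Torus d) :
    Integrable fun y => torusKernel t (x - y) * f y :=
  ((integrable_torusKernel ht).comp_sub_left x).mul_bdd (c := c) hf.aestronglyMeasurable
    (Filter.Eventually.of_forall fun y => by simpa using hc y)

open MeasureTheory in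
-- Averaging against a probability density cannot increase the sup norm. For `t ≤ 0` the definition
-- returns `f`, so no sign condition on `t` is needed.
theorem abs_heatSemigroup_le {d : ℕ} (t : ℝ) {f : Torus d → ℝ} (hf : Measurable f) {c : ℝ}
    (hc : ∀ x, |f x| ≤ c) (x : Torus d) : |heatSemigroup t f x| ≤ c := by
  by_cases ht : 0 < t
  · rw [heatSemigroup_eq_integral ht hf hc]
    calc |∫ y, torusKernel t (x - y) * f y| ≤ ∫ y, torusKernel t (x - y) * c := by
          rw [← Real.norm_eq_abs]
          refine norm_integral_le_of_norm_le (((integrable_torusKernel ht).comp_sub_left x).mul_const c)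
            (Filter.Eventually.of_forall fun y => ?_)
          rw [norm_mul, Real.norm_of_nonneg (torusKernel_nonneg ht _)]
          exact mul_le_mul_of_nonneg_left (hc y) (torusKernel_nonneg ht _)
      _ = c := by
          rw [integral_mul_const, integral_sub_left_eq_self (fun y => torusKernel t y),
            integral_torusKernel ht, one_mul]
  · rw [heatSemigroup, if_neg ht]; exact hc x

open MeasureTheory in
theorem heatSemigroup_sub {d : ℕ} (t : ℝ) {f g : Torus d → ℝ} (hf : Measurable f)
    (hg : Measurable g) {c : ℝ} (hc : ∀ x, |f x| ≤ c) (hc' : ∀ x, |g x| ≤ c) (x : Torus d) :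
    heatSemigroup t (fun y => f y - g y) x = heatSemigroup t f x - heatSemigroup t g x := by
  by_cases ht : 0 < t
  · have h : ∀ y, |f y - g y| ≤ c + c := fun y =>
      (abs_sub _ _).trans (add_le_add (hc y) (hc' y))
    rw [heatSemigroup_eq_integral ht hf hc, heatSemigroup_eq_integral ht hg hc',
      heatSemigroup_eq_integral ht (f := fun y => f y - g y) (hf.sub hg) h, ← integral_sub
        (integrable_torusKernel_mul ht hf hc x) (integrable_torusKernel_mul ht hg hc' x)]
    simp_rw [mul_sub]
  · simp only [heatSemigroup, if_neg ht]

open MeasureTheory in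
-- Joint measurability in elapsed time, source time and position serves both the integrability of
-- the Duhamel integrand and the measurability of the Duhamel term.
theorem measurable_heatSemigroup {d : ℕ} {g : ℝ × Torus d → ℝ} (hg : Measurable g) {c : ℝ}
    (hc : ∀ p, |g p| ≤ c) :
    Measurable fun p : ℝ × ℝ × Torus d =>
      heatSemigroup p.1 (fun y => g (p.2.1, y)) p.2.2 := by
  have h : ∀ p : ℝ × ℝ × Torus d, heatSemigroup p.1 (fun y => g (p.2.1, y)) p.2.2
      = if 0 < p.1 then ∫ y, torusKernel p.1 (p.2.2 - y) * g (p.2.1, y) else g p.2 := by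
    intro p
    split_ifs with hp
    · exact heatSemigroup_eq_integral hp (hg.comp measurable_prodMk_left) (fun y => hc _) _
    · rw [heatSemigroup, if_neg hp]
  simp_rw [h]
  refine Measurable.ite (measurableSet_lt measurable_const measurable_fst) ?_
    (hg.comp measurable_snd)
  have h1 : Measurable fun q : (ℝ × ℝ × Torus d) × Torus d => (q.1.1, q.1.2.2 - q.2) := by fun_prop
  have h2 : Measurable fun q : (ℝ × ℝ × Torus d) × Torus d => (q.1.2.1, q.2) := by fun_prop
  have h3 := (measurable_torusKernel (d := d)).comp h1
  have h4 := (h3.mul (hg.comp h2)).stronglyMeasurable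
  exact h4.integral_prod_right.measurable

/-! ### Picard iterates: bounds and stability in the nonlinearity. -/

/-- On `[0, T]`, the function `v` is jointly measurable and bounded by `M`. -/
def MeasurableBoundedOn {d : ℕ} (T M : ℝ) (v : ℝ → Torus d → ℝ) : Prop :=
  (∃ w : ℝ × Torus d → ℝ, Measurable w ∧ ∀ t ∈ Set.Icc 0 T, ∀ x, v t x = w (t, x)) ∧
    ∀ t ∈ Set.Icc 0 T, ∀ x, |v t x| ≤ M

/-- Truncation at `±M` gives a globally bounded representative, as the semigroup lemmas require,
without changing the values on `[0, T]`. -/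
theorem MeasurableBoundedOn.exists_extension {d : ℕ} {T M : ℝ} {v : ℝ → Torus d → ℝ} (hM : 0 ≤ M)
    (hv : MeasurableBoundedOn T M v) : ∃ w : ℝ × Torus d → ℝ, Measurable w ∧ (∀ p, |w p| ≤ M) ∧
      ∀ t ∈ Set.Icc 0 T, ∀ x, v t x = w (t, x) := by
  obtain ⟨⟨w, hw, hvw⟩, hb⟩ := hv
  refine ⟨fun p => max (-M) (min (w p) M), measurable_const.max (hw.min measurable_const),
    fun p => abs_le.2 ⟨le_max_left _ _, max_le (by linarith) (min_le_right _ _)⟩,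
    fun t ht x => ?_⟩
  have h := abs_le.1 (hb t ht x)
  rw [hvw t ht x] at h ⊢
  simp only
  rw [min_eq_left h.2, max_eq_right h.1]

theorem MeasurableBoundedOn.nonlinearity {d : ℕ} {T M L : ℝ} (hM : 0 ≤ M) (hL : 0 ≤ L)
    {v : ℝ → Torus d → ℝ} (hv : MeasurableBoundedOn T M v) {F : ℝ → ℝ}
    (hF : F ∈ nonlinearityClass M L) : MeasurableBoundedOn T (L * M) fun t x => F (v t x) := by
  obtain ⟨w, hw, hwM, hvw⟩ := hv.exists_extension hM
  have hMM : -M ≤ M := by linarith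
  -- `F` may fail to be measurable off `[-M, M]`; projecting its argument onto this interval makes
  -- it continuous.
  have hcont : Continuous fun s : ℝ => F (Set.projIcc (-M) M hMM s) := by
    have h : LipschitzOnWith (Real.toNNReal L) F (Set.Icc (-M) M) :=
      LipschitzOnWith.of_dist_le_mul fun s hs r hr => by
        rw [Real.dist_eq, Real.dist_eq, Real.coe_toNNReal L hL]; exact hF.2 s hs r hr
    exact (continuousOn_iff_continuous_domRestrict.1 h.continuousOn).comp continuous_projIcc
  refine ⟨⟨fun p => F (Set.projIcc (-M) M hMM (w p)), hcont.measurable.comp hw,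
    fun t ht x => ?_⟩, fun t ht x => ?_⟩
  · simp only
    rw [hvw t ht x, Set.projIcc_of_mem hMM (abs_le.1 (hwM _))]
  · have h := hv.2 t ht x
    have := hF.2 (v t x) (abs_le.1 h) 0 ⟨by linarith, hM⟩
    rw [hF.1, sub_zero, sub_zero] at this
    exact this.trans (mul_le_mul_of_nonneg_left h hL)

theorem MeasurableBoundedOn.measurable_slice {d : ℕ} {T c : ℝ} {f : ℝ → Torus d → ℝ}
    (hf : MeasurableBoundedOn T c f) {t : ℝ} (ht : t ∈ Set.Icc 0 T) : Measurable (f t) := by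
  obtain ⟨⟨w, hw, h⟩, -⟩ := hf
  rw [show f t = fun x => w (t, x) from funext (h t ht)]
  exact hw.comp measurable_prodMk_left

/-- The Duhamel term of the Picard map. -/
noncomputable def duhamel {d : ℕ} (f : ℝ → Torus d → ℝ) (t : ℝ) (x : Torus d) : ℝ :=
  ∫ τ in (0 : ℝ)..t, heatSemigroup (t - τ) (f τ) x

theorem abs_duhamel_le {d : ℕ} {T c : ℝ} (hc : 0 ≤ c) {f : ℝ → Torus d → ℝ}
    (hf : MeasurableBoundedOn T c f) {t : ℝ} (ht : t ∈ Set.Icc 0 T) (x : Torus d) :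
    |duhamel f t x| ≤ T * c := by
  have h := intervalIntegral.norm_integral_le_of_norm_le_const (a := 0) (b := t) (C := c)
    (f := fun τ => heatSemigroup (t - τ) (f τ) x) (fun τ hτ => by
      rw [Set.uIoc_of_le ht.1] at hτ
      have hτT : τ ∈ Set.Icc 0 T := ⟨hτ.1.le, hτ.2.trans ht.2⟩
      exact abs_heatSemigroup_le _ (hf.measurable_slice hτT) (hf.2 τ hτT) x)
  rw [sub_zero, abs_of_nonneg ht.1, mul_comm] at h
  exact h.trans (mul_le_mul_of_nonneg_right ht.2 hc)

theorem intervalIntegrable_heatSemigroup {d : ℕ} {T c : ℝ} (hc : 0 ≤ c) {f : ℝ → Torus d → ℝ}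
    (hf : MeasurableBoundedOn T c f) {t : ℝ} (ht : t ∈ Set.Icc 0 T) (x : Torus d) :
    IntervalIntegrable (fun τ => heatSemigroup (t - τ) (f τ) x) MeasureTheory.volume 0 t := by
  obtain ⟨g, hg, hgc, hfg⟩ := hf.exists_extension hc
  have hmeas : Measurable fun τ : ℝ => heatSemigroup (t - τ) (fun y => g (τ, y)) x :=
    (measurable_heatSemigroup hg hgc).comp
      (by fun_prop : Measurable fun τ : ℝ => (t - τ, τ, x))
  have hint : IntervalIntegrable (fun τ => heatSemigroup (t - τ) (fun y => g (τ, y)) x)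
      MeasureTheory.volume 0 t :=
    (intervalIntegrable_const (c := c)).mono_fun hmeas.aestronglyMeasurable
      (Filter.Eventually.of_forall fun τ => by
        rw [Real.norm_of_nonneg hc]
        exact abs_heatSemigroup_le _ (hg.comp measurable_prodMk_left) (fun y => hgc _) x)
  refine hint.congr fun τ hτ => ?_
  rw [Set.uIoc_of_le ht.1] at hτ
  rw [funext (hfg τ ⟨hτ.1.le, hτ.2.trans ht.2⟩)]

theorem duhamel_sub {d : ℕ} {T c : ℝ} (hc : 0 ≤ c) {f g : ℝ → Torus d → ℝ}
    (hf : MeasurableBoundedOn T c f) (hg : MeasurableBoundedOn T c g) {t : ℝ}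
    (ht : t ∈ Set.Icc 0 T) (x : Torus d) :
    duhamel (fun τ y => f τ y - g τ y) t x = duhamel f t x - duhamel g t x := by
  unfold duhamel
  rw [← intervalIntegral.integral_sub (intervalIntegrable_heatSemigroup hc hf ht x)
    (intervalIntegrable_heatSemigroup hc hg ht x)]
  refine intervalIntegral.integral_congr fun τ hτ => ?_
  rw [Set.uIcc_of_le ht.1] at hτ
  have hτT : τ ∈ Set.Icc 0 T := ⟨hτ.1, hτ.2.trans ht.2⟩
  exact heatSemigroup_sub _ (hf.measurable_slice hτT) (hg.measurable_slice hτT) (hf.2 τ hτT)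
    (hg.2 τ hτT) x

open MeasureTheory in
theorem exists_measurable_duhamel {d : ℕ} {T c : ℝ} (hc : 0 ≤ c) {f : ℝ → Torus d → ℝ}
    (hf : MeasurableBoundedOn T c f) : ∃ w : ℝ × Torus d → ℝ, Measurable w ∧
      ∀ t ∈ Set.Icc 0 T, ∀ x, duhamel f t x = w (t, x) := by
  obtain ⟨g, hg, hgc, hfg⟩ := hf.exists_extension hc
  -- The moving endpoint is absorbed into an indicator, so that measurability of parametric
  -- integrals over a fixed domain applies.
  refine ⟨fun p => ∫ τ, if 0 < τ ∧ τ ≤ p.1 then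
    heatSemigroup (p.1 - τ) (fun y => g (τ, y)) p.2 else 0, ?_, fun t ht x => ?_⟩
  · refine StronglyMeasurable.measurable (StronglyMeasurable.integral_prod_right
      (f := fun (p : ℝ × Torus d) τ => if 0 < τ ∧ τ ≤ p.1 then
        heatSemigroup (p.1 - τ) (fun y => g (τ, y)) p.2 else 0) (Measurable.stronglyMeasurable ?_))
    refine Measurable.ite ?_ ?_ measurable_const
    · exact (measurableSet_lt measurable_const measurable_snd).inter
        (measurableSet_le measurable_snd (measurable_fst.comp measurable_fst))
    · exact (measurable_heatSemigroup hg hgc).comp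
        (by fun_prop : Measurable fun q : (ℝ × Torus d) × ℝ => (q.1.1 - q.2, q.2, q.1.2))
  · rw [duhamel, intervalIntegral.integral_of_le ht.1, ← integral_indicator measurableSet_Ioc]
    congr 1
    ext τ
    rw [Set.indicator_apply]
    refine ite_congr rfl (fun hτ => ?_) fun _ => rfl
    rw [funext (hfg τ ⟨hτ.1.le, hτ.2.trans ht.2⟩)]

theorem picardMap_apply {d : ℕ} (F : ℝ → ℝ) (u₀ : C(Torus d, ℝ)) (v : ℝ → Torus d → ℝ) (t : ℝ)
    (x : Torus d) : picardMap F u₀ v t x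
      = heatSemigroup t u₀ x + duhamel (fun τ y => F (v τ y)) t x := rfl

theorem abs_apply_le_of_mem_initialBall {d : ℕ} {R : ℝ} (u₀ : initialBall d R) (x : Torus d) :
    |u₀.1 x| ≤ R :=
  (u₀.1.norm_coe_le_norm x).trans u₀.2

/-- The hypothesis `R + T * L * M ≤ M` is what makes the ball of radius `M` invariant. -/
theorem MeasurableBoundedOn.picardMap {d : ℕ} {R M L T : ℝ} (hM : 0 < M) (hL : 0 < L)
    (hR : R + T * L * M ≤ M) (u₀ : initialBall d R) {v : ℝ → Torus d → ℝ}
    (hv : MeasurableBoundedOn T M v) {F : ℝ → ℝ} (hF : F ∈ nonlinearityClass M L) :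
    MeasurableBoundedOn T M (picardMap F u₀.1 v) := by
  have hLM : 0 ≤ L * M := by positivity
  have hFv := hv.nonlinearity hM.le hL.le hF
  have hu : Measurable fun p : ℝ × Torus d => u₀.1 p.2 := u₀.1.continuous.measurable.comp measurable_snd
  constructor
  · obtain ⟨w, hw, h⟩ := exists_measurable_duhamel hLM hFv
    refine ⟨fun p => heatSemigroup p.1 u₀.1 p.2 + w p, Measurable.add ?_ hw, fun t ht x => ?_⟩
    · exact (measurable_heatSemigroup hu fun p => abs_apply_le_of_mem_initialBall u₀ _).comp
        (by fun_prop : Measurable fun p : ℝ × Torus d => (p.1, (0 : ℝ), p.2))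
    · rw [picardMap_apply, h t ht x]
  · intro t ht x
    rw [picardMap_apply]
    have h1 := abs_heatSemigroup_le t u₀.1.continuous.measurable
      (abs_apply_le_of_mem_initialBall u₀) x
    have h2 := abs_duhamel_le hLM hFv ht x
    refine (abs_add_le _ _).trans ((add_le_add h1 h2).trans ?_)
    linarith

/-- The terms in `u₀` cancel. In the Duhamel term, `F(v) - G(w)` splits through `F(w)`: the
Lipschitz bound controls the first piece, closeness of `F` and `G` the second. -/
theorem abs_picardMap_sub_le {d : ℕ} {R M L T : ℝ} (hM : 0 < M) (hL : 0 < L)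
    (u₀ : initialBall d R) {v w : ℝ → Torus d → ℝ} (hv : MeasurableBoundedOn T M v)
    (hw : MeasurableBoundedOn T M w) {F G : ℝ → ℝ} (hF : F ∈ nonlinearityClass M L)
    (hG : G ∈ nonlinearityClass M L) {D η : ℝ} (hD : 0 ≤ D) (hη : 0 ≤ η)
    (hvw : ∀ t ∈ Set.Icc 0 T, ∀ x, |v t x - w t x| ≤ D)
    (hFG : ∀ s ∈ Set.Icc (-M) M, |F s - G s| ≤ η) {t : ℝ} (ht : t ∈ Set.Icc 0 T) (x : Torus d) :
    |picardMap F u₀.1 v t x - picardMap G u₀.1 w t x| ≤ T * (η + L * D) := by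
  have hLM : 0 ≤ L * M := by positivity
  have hFv := hv.nonlinearity hM.le hL.le hF
  have hGw := hw.nonlinearity hM.le hL.le hG
  rw [picardMap_apply, picardMap_apply, add_sub_add_left_eq_sub, ← duhamel_sub hLM hFv hGw ht]
  refine abs_duhamel_le (by positivity) ⟨?_, fun τ hτ y => ?_⟩ ht x
  · obtain ⟨⟨f, hf, hf'⟩, -⟩ := hFv
    obtain ⟨⟨g, hg, hg'⟩, -⟩ := hGw
    exact ⟨fun p => f p - g p, hf.sub hg, fun τ hτ y => congrArg₂ _ (hf' τ hτ y) (hg' τ hτ y)⟩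
  · have hvI := abs_le.1 (hv.2 τ hτ y)
    have hwI := abs_le.1 (hw.2 τ hτ y)
    have h1 := (hF.2 _ hvI _ hwI).trans (mul_le_mul_of_nonneg_left (hvw τ hτ y) hL.le)
    have h2 := hFG _ hwI
    calc |F (v τ y) - G (w τ y)| ≤ |F (v τ y) - F (w τ y)| + |F (w τ y) - G (w τ y)| :=
          abs_sub_le _ _ _
      _ ≤ η + L * D := by linarith

theorem measurableBoundedOn_picard_iterate {d : ℕ} {R M L T : ℝ} (hM : 0 < M) (hL : 0 < L)
    (hR : R + T * L * M ≤ M) (u₀ : initialBall d R) {F : ℝ → ℝ} (hF : F ∈ nonlinearityClass M L)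
    (ℓ : ℕ) : MeasurableBoundedOn T M ((picardMap F u₀.1)^[ℓ] fun _ _ => 0) := by
  induction ℓ with
  | zero => exact ⟨⟨fun _ => 0, measurable_const, fun _ _ _ => rfl⟩, fun _ _ _ => by simpa using hM.le⟩
  | succ ℓ ih =>
    rw [Function.iterate_succ_apply']
    exact ih.picardMap hM hL hR u₀ hF

theorem abs_picard_iterate_sub_le {d : ℕ} {R M L T δ : ℝ} (hM : 0 < M) (hL : 0 < L) (hT : 0 < T)
    (hR : R + T * L * M ≤ M) (hδ : T * L ≤ δ) (u₀ : initialBall d R) {F G : ℝ → ℝ}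
    (hF : F ∈ nonlinearityClass M L) (hG : G ∈ nonlinearityClass M L) {η : ℝ} (hη : 0 ≤ η)
    (hFG : ∀ s ∈ Set.Icc (-M) M, |F s - G s| ≤ η) (ℓ : ℕ) :
    ∀ t ∈ Set.Icc 0 T, ∀ x, |(picardMap F u₀.1)^[ℓ] (fun _ _ => 0) t x
      - (picardMap G u₀.1)^[ℓ] (fun _ _ => 0) t x| ≤ T * η * ∑ k ∈ Finset.range ℓ, δ ^ k := by
  have hδ0 : 0 ≤ δ := le_trans (by positivity) hδ
  induction ℓ with
  | zero => intro t _ x; simp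
  | succ ℓ ih =>
    intro t ht x
    rw [Function.iterate_succ_apply', Function.iterate_succ_apply']
    have hS : 0 ≤ ∑ k ∈ Finset.range ℓ, δ ^ k := Finset.sum_nonneg fun k _ => by positivity
    refine (abs_picardMap_sub_le hM hL u₀ (measurableBoundedOn_picard_iterate hM hL hR u₀ hF ℓ)
      (measurableBoundedOn_picard_iterate hM hL hR u₀ hG ℓ) hF hG (by positivity) hη ih hFG ht
      x).trans ?_
    rw [geom_sum_succ]
    calc T * (η + L * (T * η * ∑ k ∈ Finset.range ℓ, δ ^ k))
        = T * η * ((T * L) * ∑ k ∈ Finset.range ℓ, δ ^ k + 1) := by ring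
      _ ≤ T * η * (δ * ∑ k ∈ Finset.range ℓ, δ ^ k + 1) := by gcongr

/-! ### From entropy to Rademacher complexity. -/

/-- The sample values of the class, as vectors indexed by the pairs `(i, j)`. -/
def sampleValues {X Z : Type*} {n q : ℕ} (B : Set (X → Z → ℝ)) (a : Fin n → X)
    (z : Fin n → Fin q → Z) : Set (Fin n × Fin q → ℝ) :=
  (fun b p => b (a p.1) (z p.1 p.2)) '' B

open scoped Pointwise in
theorem rademacherSum_image_eq {X Z : Type*} {n q : ℕ} (B : Set (X → Z → ℝ)) (a : Fin n → X)
    (z : Fin n → Fin q → Z) (σ : Fin n → Fin q → ℤˣ) :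
    rademacherSum a z σ '' B = (1 / (n * Real.sqrt q)) •
      ((fun b : Fin n × Fin q → ℝ => ∑ p, ((σ p.1 p.2 : ℤ) : ℝ) * b p) ''
        sampleValues B a z) := by
  rw [sampleValues, Set.image_image, ← Set.image_smul, Set.image_image]
  refine Set.image_congr fun b _ => ?_
  rw [rademacherSum, smul_eq_mul, Fintype.sum_prod_type]

theorem rademacherComplexity_eq {X Z : Type*} {n q : ℕ} (B : Set (X → Z → ℝ)) (a : Fin n → X)
    (z : Fin n → Fin q → Z) :
    rademacherComplexity B a z = (1 / (n * Real.sqrt q)) * (∑ σ : Fin n × Fin q → ℤˣ,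
      sSup ((fun b : Fin n × Fin q → ℝ => ∑ p, ((σ p : ℤ) : ℝ) * b p) '' sampleValues B a z))
        / 2 ^ (n * q) := by
  rw [rademacherComplexity, Finset.mul_sum]
  congr 1
  refine Fintype.sum_equiv (Equiv.curry (Fin n) (Fin q) ℤˣ).symm _ _ fun σ => ?_
  rw [rademacherSum_image_eq, Real.sSup_smul_of_nonneg (by positivity), smul_eq_mul]
  rfl

theorem abs_picardPredictor_le {d : ℕ} {R M L T : ℝ} (hM : 0 < M) (hL : 0 < L)
    (hR : R + T * L * M ≤ M) {F : ℝ → ℝ} (hF : F ∈ nonlinearityClass M L) (ℓ : ℕ)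
    (u₀ : initialBall d R) (z : spaceTime d T) : |picardPredictor d R T ℓ F u₀ z| ≤ M :=
  (measurableBoundedOn_picard_iterate hM hL hR u₀ hF ℓ).2 _ (Set.Ioo_subset_Icc_self z.2) _

theorem zero_mem_nonlinearityClass {M L : ℝ} (hL : 0 ≤ L) :
    (fun _ => 0) ∈ nonlinearityClass M L :=
  ⟨rfl, fun s _ r _ => by simpa using mul_nonneg hL (abs_nonneg _)⟩

theorem abs_le_of_mem_sampleValues {d : ℕ} {R M L T : ℝ} (hM : 0 < M) (hL : 0 < L)
    (hR : R + T * L * M ≤ M) {ℓ n q : ℕ} (a : Fin n → initialBall d R)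
    (z : Fin n → Fin q → spaceTime d T) {b : Fin n × Fin q → ℝ}
    (hb : b ∈ sampleValues (picardClass d R M L T ℓ) a z) (p : Fin n × Fin q) : |b p| ≤ M := by
  obtain ⟨_, ⟨F, hF, rfl⟩, rfl⟩ := hb
  exact abs_picardPredictor_le hM hL hR hF ℓ _ _

/-- The entropy of the Picard class is inherited from that of the nonlinearities. -/
theorem exists_net_sampleValues {d : ℕ} {R M L T δ : ℝ} (hM : 0 < M) (hL : 0 < L) (hT : 0 < T)
    (hR : R + T * L * M ≤ M) (hδ : T * L ≤ δ) {ℓ n q : ℕ}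
    (hS : 0 < ∑ k ∈ Finset.range ℓ, δ ^ k) (a : Fin n → initialBall d R)
    (z : Fin n → Fin q → spaceTime d T) {ε : ℝ} (hε : 0 < ε) :
    ∃ S : Finset (Fin n × Fin q → ℝ),
      S.card ≤ 9 ^ ⌊3 * (L * T * ∑ k ∈ Finset.range ℓ, δ ^ k) * M / ε⌋₊ ∧
      ∀ b ∈ sampleValues (picardClass d R M L T ℓ) a z, ∃ p ∈ S, ∀ i, |b i - p i| ≤ ε := by
  classical
  set s := ∑ k ∈ Finset.range ℓ, δ ^ k with hs
  -- The factor `3` is the loss in the grid net and `T * s` is the Lipschitz constant of `F ↦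
  -- b_{F,ℓ}`.
  have hη : 0 < ε / (3 * T * s) := by positivity
  obtain ⟨P, hPs, hPc, hP⟩ := exists_net_nonlinearityClass hM hL hη
  refine ⟨P.image fun F p => picardPredictor d R T ℓ F (a p.1) (z p.1 p.2), ?_, ?_⟩
  · refine Finset.card_image_le.trans (hPc.trans (le_of_eq ?_))
    congr 2
    field_simp
  · rintro _ ⟨_, ⟨F, hF, rfl⟩, rfl⟩
    obtain ⟨G, hG, hFG⟩ := hP F hF
    refine ⟨_, Finset.mem_image_of_mem _ hG, fun p => ?_⟩
    refine (abs_picard_iterate_sub_le hM hL hT hR hδ (a p.1) hF (hPs hG) (by positivity) hFG ℓ _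
      (Set.Ioo_subset_Icc_self (z p.1 p.2).2) _).trans (le_of_eq ?_)
    rw [← hs]
    field_simp

theorem rademacherComplexity_picardClass_zero {d : ℕ} {R M L T : ℝ} (hL : 0 ≤ L) {n q : ℕ}
    (a : Fin n → initialBall d R) (z : Fin n → Fin q → spaceTime d T) :
    rademacherComplexity (picardClass d R M L T 0) a z = 0 := by
  have h : picardClass d R M L T 0 = {fun _ _ => 0} := by
    refine Set.Subset.antisymm ?_ ?_
    · rintro _ ⟨F, _, rfl⟩; rfl
    · rintro _ rfl; exact ⟨_, zero_mem_nonlinearityClass hL, rfl⟩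
  simp [rademacherComplexity, h, rademacherSum]

theorem rademacherComplexity_picardClass_le {d : ℕ} {R M L T δ : ℝ} (hM : 0 < M) (hL : 0 < L)
    (hT : 0 < T) (hR : R + T * L * M ≤ M) (hδ : T * L ≤ δ) (ℓ : ℕ) {n q : ℕ} (hn : 1 ≤ n)
    (hq : 1 ≤ q) (a : Fin n → initialBall d R) (z : Fin n → Fin q → spaceTime d T) :
    rademacherComplexity (picardClass d R M L T ℓ) a z
      ≤ 60 * M * Real.sqrt (L * T * (∑ k ∈ Finset.range ℓ, δ ^ k) / n) := by
  -- For `ℓ = 0` the geometric sum vanishes, whereas the entropy bound needs `A > 0`; the class is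
  -- then the zero function alone.
  rcases Nat.eq_zero_or_pos ℓ with rfl | hℓ
  · rw [rademacherComplexity_picardClass_zero hL.le]; positivity
  have hδ0 : 0 ≤ δ := le_trans (by positivity) hδ
  have hS : 0 < ∑ k ∈ Finset.range ℓ, δ ^ k := geom_sum_pos hδ0 hℓ.ne'
  have : Nonempty (Fin n × Fin q) := ⟨⟨0, hn⟩, ⟨0, hq⟩⟩
  have hB : (sampleValues (picardClass d R M L T ℓ) a z).Nonempty :=
    ⟨_, _, ⟨_, zero_mem_nonlinearityClass hL.le, rfl⟩, rfl⟩
  have h := sum_signs_sSup_le_of_entropy _ hB hM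
    (A := L * T * ∑ k ∈ Finset.range ℓ, δ ^ k) (by positivity)
    (fun b hb => abs_le_of_mem_sampleValues hM hL hR a z hb)
    (fun ε hε => exists_net_sampleValues hM hL hT hR hδ hS a z hε)
  rw [rademacherComplexity_eq]
  set s := ∑ k ∈ Finset.range ℓ, δ ^ k with hs
  simp only [Fintype.card_prod, Fintype.card_fin, Nat.cast_mul] at h
  have hn0 : (0 : ℝ) < n := by exact_mod_cast hn
  have hq0 : (0 : ℝ) < q := by exact_mod_cast hq
  rw [div_le_iff₀ (by positivity)]
  refine (mul_le_mul_of_nonneg_left h (by positivity)).trans (le_of_eq ?_)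
  -- The normalization `1 / (n√q)` is matched to `√(nq)`, which removes `q` from the bound.
  have h1 : Real.sqrt (n * q * (L * T * s)) = n * Real.sqrt q * Real.sqrt (L * T * s / n) := by
    rw [show (n * q * (L * T * s) : ℝ) = n ^ 2 * q * (L * T * s / n) by field_simp,
      Real.sqrt_mul (by positivity), Real.sqrt_mul (by positivity), Real.sqrt_sq hn0.le]
  rw [h1]
  have hq1 : 0 < Real.sqrt q := Real.sqrt_pos.2 hq0
  field_simp

theorem bddAbove_rademacherSum_picardClass {d : ℕ} {R M L T : ℝ} (hM : 0 < M) (hL : 0 < L)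
    (hR : R + T * L * M ≤ M) (ℓ : ℕ) {n q : ℕ} (a : Fin n → initialBall d R)
    (z : Fin n → Fin q → spaceTime d T) (σ : Fin n → Fin q → ℤˣ) :
    BddAbove (rademacherSum a z σ '' picardClass d R M L T ℓ) := by
  refine ⟨1 / (n * Real.sqrt q) * ∑ _i : Fin n, ∑ _j : Fin q, M, ?_⟩
  rintro _ ⟨_, ⟨F, hF, rfl⟩, rfl⟩
  refine mul_le_mul_of_nonneg_left ?_ (by positivity)
  refine Finset.sum_le_sum fun i _ => Finset.sum_le_sum fun j _ => (le_abs_self _).trans ?_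
  have h1 : |((σ i j : ℤ) : ℝ)| = 1 := by
    rcases Int.units_eq_one_or (σ i j) with h | h <;> simp [h]
  rw [abs_mul, h1, one_mul]
  exact abs_picardPredictor_le hM hL hR hF ℓ _ _

theorem lemma6p3 :
    ∃ C : ℝ, 0 < C ∧
      ∀ (d : ℕ) (_ : 1 ≤ d) (R M L T δ : ℝ) (_ : 0 < R) (_ : 0 < M) (_ : 0 < L) (_ : 0 < T)
        (_ : R + T * L * M ≤ M) (_ : T * L ≤ δ) (_ : δ < 1)
        (ℓ n q : ℕ) (_ : 1 ≤ n) (_ : 1 ≤ q)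
        (a : Fin n → initialBall d R) (z : Fin n → Fin q → spaceTime d T),
        (∀ σ : Fin n → Fin q → ℤˣ, BddAbove (rademacherSum a z σ '' picardClass d R M L T ℓ)) ∧
        rademacherComplexity (picardClass d R M L T ℓ) a z
          ≤ C * M * Real.sqrt (L * T * (1 - δ ^ ℓ) / ((1 - δ) * n)) ∧
        rademacherComplexity (picardClass d R M L T ℓ) a z
          ≤ C * M * Real.sqrt (L * T / ((1 - δ) * n)) := by
  refine ⟨60, by norm_num, ?_⟩
  intro d _ R M L T δ _ hM hL hT hR hδ hδ1 ℓ n q hn hq a z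
  have hδ0 : 0 ≤ δ := le_trans (by positivity) hδ
  have hδ' : 0 < 1 - δ := by linarith
  have hn0 : (0 : ℝ) < n := by exact_mod_cast hn
  have h := rademacherComplexity_picardClass_le hM hL hT hR hδ ℓ hn hq a z
  have hgeom : L * T * (∑ k ∈ Finset.range ℓ, δ ^ k) / n
      = L * T * (1 - δ ^ ℓ) / ((1 - δ) * n) := by
    rw [← mul_neg_geom_sum δ ℓ]
    field_simp
  rw [hgeom] at h
  refine ⟨bddAbove_rademacherSum_picardClass hM hL hR ℓ a z, h, h.trans ?_⟩
  have hδℓ : 0 ≤ δ ^ ℓ := by positivity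
  have hnum : L * T * (1 - δ ^ ℓ) ≤ L * T := mul_le_of_le_one_right (by positivity) (by linarith)
  exact mul_le_mul_of_nonneg_left
    (Real.sqrt_le_sqrt (div_le_div_of_nonneg_right hnum (by positivity))) (by positivity)
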